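/- Consider $y = X\beta + \epsilon$ with $y \in \mathbb{R}^n$, a known $n \times p$ design matrix $X$, $\epsilon \sim N(0, \sigma^2 I_n)$ and known $\sigma > 0$. Let $r = \mathrm{rank}(X)$ and assume that any $r$ columns of $X$ are linearly independent. A model is a set $M$ of predictors, $|M|$ is its size, and $\hat\beta_M = (D_M X'X D_M)^+ D_M X' y$, where $D_M$ is the diagonal indicator matrix of $M$ and $^+$ is the Moore–Penrose inverse, is its least squares estimator. Let $\Omega$ be a fixed set of admissible models of sizes at most $r$ that contains the null model, let $m(k)$ be the number of admissible models of size $k$ (so $m(0) = 1$), and assume $m(r) = 1$. Let $\pi$ be a probability distribution on $\{0, \dots, r\}$ with $\pi(k) = 0$ if and only if $m(k) = 0$. For $\gamma > 0$ put $c(\gamma) = 8(\gamma + 3/4)^2$ and, for $m(k) > 0$, $$Pen(k) = 2\sigma^2 (1 + 1/\gamma) \ln\left\{ m(k) \pi(k)^{-1} (1 + \gamma)^{k/2} \right\}.$$ Let $\hat M$ be a minimizer of $\|y - X\hat\beta_M\|^2 + Pen(|M|)$ over $M \in \Omega$ (the MAP model selector). Assume that for some $c > 0$ $$\min\{ m(k)^{-c},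 e^{-ck} \} \le \pi(k) \le m(k) e^{-c(\gamma) k} \quad \text{for all } k = 1, \dots, r \text{ with } m(k) > 0.$$ For a set $\mathcal{M}$ of models let $R(\mathcal{M}) = \sup E\|X\hat\beta_{\hat M} - X\beta\|^2$, where the supremum is over all $\beta \in \mathbb{R}^p$ whose support is contained in some $M \in \mathcal{M}$. Let $\mathcal{M}_{p_0}$ and $\mathfrak{M}_{p_0}$ be the sets of admissible models of size exactly $p_0$ and of size at most $p_0$. There is a constant $C(\gamma) > 0$, depending only on $\gamma$, such that simultaneously for all $1 \le p_0 \le r$: 1. if $m(p_0) > 0$ and either $p_0 = r$ or $Pen(k) \le Pen(p_0)$ for all $1 \le k < p_0$ with $m(k) > 0$ (in particular, for every $p_0$ with $m(p_0) > 0$ if the penalty increases with the model size), then $$R(\mathfrak{M}_{p_0}) \le C(\gamma) (1 + c)\, \sigma^2 \min\left\{ \max(p_0, \ln m(p_0)), r \right\};$$ 2. if $m(p_0) > 0$, then, with no condition on the penalty, $R(\mathcal{M}_{p_0}) \le C(\gamma) (1 + c)\, \sigma^2 \min\{ \max(p_0, \ln m(p_0)), r \}$; 3. if $\mathfrak{M}_{p_0}$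 contains a model other than the null model, then, with no condition on the penalty, $$R(\mathfrak{M}_{p_0}) \le C(\gamma) (1 + c)\, \sigma^2 \min\left\{ \max\left(p_0, \max_{1 \le k \le p_0} \ln m(k)\right), r \right\}.$$ -/

import Mathlib

open MeasureTheory ProbabilityTheory

namespace MAPSelection

/-- `B` is the Moore--Penrose generalized inverse of the real matrix `A`. -/
structure IsMoorePenrose {m n : ℕ} (A : Matrix (Fin m) (Fin n) ℝ)
    (B : Matrix (Fin n) (Fin m) ℝ) : Prop where
  mul_mul_left : A * B * A = A
  mul_mul_right : B * A * B = B
  transpose_left : (A * B).transpose = A * B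
  transpose_right : (B * A).transpose = B * A

theorem IsMoorePenrose.unique {m n : ℕ} {A : Matrix (Fin m) (Fin n) ℝ}
    {B C : Matrix (Fin n) (Fin m) ℝ} (hB : IsMoorePenrose A B) (hC : IsMoorePenrose A C) :
    B = C := by
  have h1 : A * B = A * C := by
    calc A * B = (A * B).transpose := hB.transpose_left.symm
      _ = (A * C * (A * B)).transpose := by
          rw [← Matrix.mul_assoc, hC.mul_mul_left]
      _ = A * B * (A * C) := by
          rw [Matrix.transpose_mul, hB.transpose_left, hC.transpose_left]
      _ = A * C := by rw [← Matrix.mul_assoc, hB.mul_mul_left]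
  have h2 : B * A = C * A := by
    calc B * A = (B * A).transpose := hB.transpose_right.symm
      _ = (B * A * (C * A)).transpose := by
          rw [← Matrix.mul_assoc, Matrix.mul_assoc B A C, Matrix.mul_assoc B (A * C) A,
            hC.mul_mul_left]
      _ = C * A * (B * A) := by
          rw [Matrix.transpose_mul, hB.transpose_right, hC.transpose_right]
      _ = C * A := by
          rw [← Matrix.mul_assoc, Matrix.mul_assoc C A B, Matrix.mul_assoc C (A * B) A,
            hB.mul_mul_left]
  calc B = B * A * B := hB.mul_mul_right.symm
    _ = C * (A * B) := by rw [h2, Matrix.mul_assoc]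
    _ = C * A * C := by rw [h1, ← Matrix.mul_assoc]
    _ = C := hC.mul_mul_right

/-- Every real symmetric matrix has a Moore--Penrose inverse. -/
theorem exists_isMoorePenrose {p : ℕ} (A : Matrix (Fin p) (Fin p) ℝ)
    (hA : A.transpose = A) : ∃ B, IsMoorePenrose A B := by
  have hH : A.IsHermitian := by
    rw [Matrix.IsHermitian, Matrix.conjTranspose_eq_transpose_of_trivial]; exact hA
  obtain ⟨U, d, hU, hAU⟩ : ∃ (U : Matrix (Fin p) (Fin p) ℝ) (d : Fin p → ℝ),
      U.transpose * U = 1 ∧ A = U * Matrix.diagonal d * U.transpose := by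
    refine ⟨(hH.eigenvectorUnitary : Matrix (Fin p) (Fin p) ℝ), hH.eigenvalues, ?_, ?_⟩
    · have := Unitary.coe_star_mul_self hH.eigenvectorUnitary
      simpa [Matrix.star_eq_conjTranspose, Matrix.conjTranspose_eq_transpose_of_trivial] using this
    · have := hH.spectral_theorem
      rw [Unitary.conjStarAlgAut_apply] at this
      simpa [Matrix.star_eq_conjTranspose, Matrix.conjTranspose_eq_transpose_of_trivial,
        Function.comp_def] using this
  have key : ∀ a b : Fin p → ℝ,
      (U * Matrix.diagonal a * U.transpose) * (U * Matrix.diagonal b * U.transpose)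
        = U * Matrix.diagonal (fun i => a i * b i) * U.transpose := by
    intro a b
    calc (U * Matrix.diagonal a * U.transpose) * (U * Matrix.diagonal b * U.transpose)
        = U * Matrix.diagonal a * (U.transpose * U) * Matrix.diagonal b * U.transpose := by
          simp only [Matrix.mul_assoc]
      _ = U * Matrix.diagonal (fun i => a i * b i) * U.transpose := by
          rw [hU, Matrix.mul_one, Matrix.mul_assoc U, Matrix.diagonal_mul_diagonal]
  have tr : ∀ a : Fin p → ℝ, (U * Matrix.diagonal a * U.transpose).transpose
      = U * Matrix.diagonal a * U.transpose := by
    intro a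
    simp [Matrix.transpose_mul, Matrix.mul_assoc]
  refine ⟨U * Matrix.diagonal (fun i => (d i)⁻¹) * U.transpose, ?_, ?_, ?_, ?_⟩
  · rw [hAU, key, key]; simp
  · rw [hAU, key, key]
    congr 3
    funext i
    by_cases h : d i = 0 <;> simp [h]
  · rw [hAU, key, tr]
  · rw [hAU, key, tr]

open Classical in
/-- The Moore--Penrose inverse `A⁺`. -/
noncomputable def pinv {m n : ℕ} (A : Matrix (Fin m) (Fin n) ℝ) : Matrix (Fin n) (Fin m) ℝ :=
  if h : ∃ B, IsMoorePenrose A B then h.choose else 0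

theorem pinv_spec {p : ℕ} (A : Matrix (Fin p) (Fin p) ℝ) (hA : A.transpose = A) :
    IsMoorePenrose A (pinv A) := by
  have h := exists_isMoorePenrose A hA
  rw [pinv, dif_pos h]
  exact h.choose_spec

/-- Squared Euclidean norm. -/
def sqNorm {n : ℕ} (v : Fin n → ℝ) : ℝ := ∑ i, v i ^ 2

/-- The diagonal indicator matrix `D_M` of a model `M`, a set of predictors. -/
def indicatorMatrix {p : ℕ} (M : Finset (Fin p)) : Matrix (Fin p) (Fin p) ℝ :=
  Matrix.diagonal (fun j => if j ∈ M then 1 else 0)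

/-- Least squares estimator of the coefficients in the model `M`:
`(D_M X' X D_M)⁺ D_M X' y`. -/
noncomputable def lse {n p : ℕ} (X : Matrix (Fin n) (Fin p) ℝ) (M : Finset (Fin p))
    (y : Fin n → ℝ) : Fin p → ℝ :=
  (pinv (indicatorMatrix M * X.transpose * X * indicatorMatrix M) * indicatorMatrix M
    * X.transpose).mulVec y

/-- The admissible models of size exactly `k`. -/
def modelsOfSize {p : ℕ} (Ω : Finset (Finset (Fin p))) (k : ℕ) : Finset (Finset (Fin p)) :=
  Ω.filter (fun M => M.card = k)

/-- The admissible models of size at most `k`. -/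
def modelsUpTo {p : ℕ} (Ω : Finset (Finset (Fin p))) (k : ℕ) : Finset (Finset (Fin p)) :=
  Ω.filter (fun M => M.card ≤ k)

/-- The number `m(k)` of admissible models of size `k`. -/
def modelCount {p : ℕ} (Ω : Finset (Finset (Fin p))) (k : ℕ) : ℕ := (modelsOfSize Ω k).card

/-- The setting: any `r = rank X` columns of the design are linearly independent, the null
model is admissible, admissible models have size at most `r`, and there is exactly one of
size `r` (the saturated model). -/
structure IsSetting {n p : ℕ} (X : Matrix (Fin n) (Fin p) ℝ) (Ω : Finset (Finset (Fin p)))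
    (r : ℕ) : Prop where
  rank_eq : X.rank = r
  linearIndependent : ∀ S : Finset (Fin p), S.card = r →
    LinearIndependent ℝ (fun j : S => X.transpose j)
  null_mem : ∅ ∈ Ω
  card_le : ∀ M ∈ Ω, M.card ≤ r
  count_rank : modelCount Ω r = 1

/-- `π` is a prior on the model size `0, …, r`, vanishing exactly at the sizes that no
admissible model has. -/
structure IsSizePrior {p : ℕ} (Ω : Finset (Finset (Fin p))) (r : ℕ) (π : ℕ → ℝ) : Prop where
  nonneg : ∀ k ≤ r, 0 ≤ π k
  sum_eq_one : ∑ k ∈ Finset.range (r + 1), π k = 1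
  eq_zero_iff : ∀ k ≤ r, (π k = 0 ↔ modelCount Ω k = 0)

/-- The constant `c(γ) = 8 (γ + 3/4)²`. -/
noncomputable def cGamma (γ : ℝ) : ℝ := 8 * (γ + 3 / 4) ^ 2

/-- The two-sided condition `min (m(k)^(-c)) (e^(-ck)) ≤ π(k) ≤ m(k) e^(-c(γ) k)` on the prior. -/
def PriorBounds {p : ℕ} (Ω : Finset (Finset (Fin p))) (r : ℕ) (γ c : ℝ) (π : ℕ → ℝ) : Prop :=
  ∀ k : ℕ, 1 ≤ k → k ≤ r → 0 < modelCount Ω k →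
    min ((modelCount Ω k : ℝ) ^ (-c)) (Real.exp (-c * k)) ≤ π k ∧
      π k ≤ modelCount Ω k * Real.exp (-cGamma γ * k)

/-- The complexity penalty `2σ²(1 + 1/γ) ln (m(k) π(k)⁻¹ (1 + γ)^(k/2))`, meaningful at
the sizes `k` with `m(k) > 0`. -/
noncomputable def pen {p : ℕ} (Ω : Finset (Finset (Fin p))) (σ γ : ℝ) (π : ℕ → ℝ) (k : ℕ) : ℝ :=
  2 * σ ^ 2 * (1 + 1 / γ) *
    Real.log (modelCount Ω k * (π k)⁻¹ * (1 + γ) ^ ((k : ℝ) / 2))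

/-- The penalized least squares criterion of a model `M` at the data `y`. -/
noncomputable def criterion {n p : ℕ} (X : Matrix (Fin n) (Fin p) ℝ)
    (Ω : Finset (Finset (Fin p))) (σ γ : ℝ) (π : ℕ → ℝ) (y : Fin n → ℝ)
    (M : Finset (Fin p)) : ℝ :=
  sqNorm (y - X.mulVec (lse X M y)) + pen Ω σ γ π M.card

/-- `Mhat` is a MAP model selector: at every `y` it picks an admissible model minimizing the
criterion (ties are broken in any way). -/
def IsMAPSelector {n p : ℕ} (X : Matrix (Fin n) (Fin p) ℝ) (Ω : Finset (Finset (Fin p)))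
    (σ γ : ℝ) (π : ℕ → ℝ) (Mhat : (Fin n → ℝ) → Finset (Fin p)) : Prop :=
  ∀ y, Mhat y ∈ Ω ∧ ∀ M ∈ Ω, criterion X Ω σ γ π y (Mhat y) ≤ criterion X Ω σ γ π y M

/-- The law `N(0, σ² I_n)` of the noise. -/
noncomputable def noiseLaw (n : ℕ) (σ : ℝ) : Measure (Fin n → ℝ) :=
  Measure.pi (fun _ => gaussianReal 0 (σ ^ 2).toNNReal)

/-- The quadratic risk `E ‖X β̂_{M̂} - X β‖²` under `y = X β + ε`, with values in `[0, ∞]`. -/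
noncomputable def risk {n p : ℕ} (X : Matrix (Fin n) (Fin p) ℝ) (σ : ℝ)
    (Mhat : (Fin n → ℝ) → Finset (Fin p)) (β : Fin p → ℝ) : ENNReal :=
  ∫⁻ ε, ENNReal.ofReal (sqNorm
    (X.mulVec (lse X (Mhat (X.mulVec β + ε)) (X.mulVec β + ε)) - X.mulVec β)) ∂(noiseLaw n σ)

/-- The supremum of the risk over the coefficient vectors supported in some model of `S`. -/
noncomputable def worstRisk {n p : ℕ} (X : Matrix (Fin n) (Fin p) ℝ) (σ : ℝ)
    (Mhat : (Fin n → ℝ) → Finset (Fin p)) (S : Finset (Finset (Fin p))) : ENNReal :=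
  ⨆ (M ∈ S) (β : Fin p → ℝ) (_ : ∀ j, j ∉ M → β j = 0), risk X σ Mhat β

end MAPSelection

namespace MAPSelection

/-! ### Least squares fits as projections, from the Moore–Penrose identities. -/

section Projection

/-! Comparing the selected model `m` with a true model `M` bounds the loss by `Pen(|M|) + 2 ε·v -
Pen(|m|)`, where `v` is the error of the fitted mean (`sqNorm_selected_sub_le`). As `v` lies in a
space of dimension at most `|m| + 1`, the cross term is absorbed into a fraction of the loss plus a
multiple of a chi-square variable. The excess `t` of that variable over the penalty is at most
`e^t`, hence at most the sum of such exponentials over all admissible models, which no longer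
involves the random choice (`sqNorm_selected_sub_le_sum_exp`).

The expected exponential of a model of size `k` is at most a constant times `π(k) / m(k)`
(`exp_neg_pen_mul_le`), and these weights have total at most 1. So the risk is at most a multiple of
`Pen(|M|)` plus one of `σ²` (`risk_le_pen`).

The lower bound on the prior makes `Pen(k)` of order `max(k, ln m(k))` (`pen_le`). The alternative
bound by `r` holds because the saturated model represents every mean vector and `ln m(r) = 0`
(`risk_le_rank`). -/

theorem sqNorm_eq_dotProduct {n : ℕ} (v : Fin n → ℝ) : sqNorm v = v ⬝ᵥ v := by
  simp [sqNorm, dotProduct, sq]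

theorem sqNorm_add {n : ℕ} (u v : Fin n → ℝ) :
    sqNorm (u + v) = sqNorm u + 2 * (u ⬝ᵥ v) + sqNorm v := by
  simp only [sqNorm_eq_dotProduct, add_dotProduct, dotProduct_add, dotProduct_comm v u]
  ring

theorem sqNorm_nonneg {n : ℕ} (v : Fin n → ℝ) : 0 ≤ sqNorm v :=
  Finset.sum_nonneg fun _ _ => sq_nonneg _

variable {n p : ℕ}

theorem indicatorMatrix_transpose (M : Finset (Fin p)) :
    (indicatorMatrix M).transpose = indicatorMatrix M := by
  simp [indicatorMatrix]

theorem indicatorMatrix_mul_self (M : Finset (Fin p)) :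
    indicatorMatrix M * indicatorMatrix M = indicatorMatrix M := by
  simp [indicatorMatrix, Matrix.diagonal_mul_diagonal]

theorem indicatorMatrix_mulVec_eq_self_iff (M : Finset (Fin p)) (b : Fin p → ℝ) :
    (indicatorMatrix M).mulVec b = b ↔ ∀ j, j ∉ M → b j = 0 := by
  simp only [indicatorMatrix, funext_iff, Matrix.mulVec_diagonal]
  refine forall_congr' fun j => ?_
  by_cases h : j ∈ M <;> simp [h, eq_comm]

theorem gram_transpose (X : Matrix (Fin n) (Fin p) ℝ) (M : Finset (Fin p)) :
    (indicatorMatrix M * X.transpose * X * indicatorMatrix M).transpose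
      = indicatorMatrix M * X.transpose * X * indicatorMatrix M := by
  simp [Matrix.transpose_mul, indicatorMatrix_transpose, Matrix.mul_assoc]

/-- If `A` is symmetric and `D A = A`, then `D A⁺ = A⁺`. -/
theorem IsMoorePenrose.mul_eq_of_mul_eq {A D G : Matrix (Fin p) (Fin p) ℝ}
    (h : IsMoorePenrose A G) (hA : A.transpose = A) (hD : D * A = A) : D * G = G := by
  -- Symmetry of `G * A` moves a factor `A` to the far left of `G`, where it absorbs `D`.
  have hG : G = A * (G.transpose * G) := by
    calc G = (G * A).transpose * G := by rw [h.transpose_right, h.mul_mul_right]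
      _ = A * (G.transpose * G) := by rw [Matrix.transpose_mul, hA, Matrix.mul_assoc]
  rw [hG, ← Matrix.mul_assoc, hD]

/-- `BᵀB (BᵀB)⁺ Bᵀ = Bᵀ`. -/
theorem IsMoorePenrose.gram_mul_mul_transpose {B : Matrix (Fin n) (Fin p) ℝ}
    {G : Matrix (Fin p) (Fin p) ℝ} (h : IsMoorePenrose (B.transpose * B) G) :
    B.transpose * B * G * B.transpose = B.transpose := by
  set A := B.transpose * B with hAdef
  have hA : A.transpose = A := by simp [hAdef, Matrix.transpose_mul]
  have hAAG : A * (A * G) = A := by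
    calc A * (A * G) = (A * G * A).transpose := by
          rw [Matrix.transpose_mul, h.transpose_left, hA]
      _ = A := by rw [h.mul_mul_left, hA]
  -- This matrix `K` is killed by `Bᵀ` and factors as `B (1 - AG)`, so `KᵀK = 0`; over the reals
  -- this forces `K = 0`.
  have hK : B - B * (A * G) = 0 := by
    rw [← Matrix.conjTranspose_mul_self_eq_zero, Matrix.conjTranspose_eq_transpose_of_trivial]
    have h0 : B.transpose * (B - B * (A * G)) = 0 := by
      rw [Matrix.mul_sub, ← Matrix.mul_assoc, ← hAdef, hAAG, sub_self]
    have hKK : B - B * (A * G) = B * (1 - A * G) := by rw [Matrix.mul_sub, Matrix.mul_one]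
    calc (B - B * (A * G)).transpose * (B - B * (A * G))
        = (1 - A * G).transpose * (B.transpose * (B - B * (A * G))) := by
          nth_rewrite 1 [hKK]
          rw [Matrix.transpose_mul, Matrix.mul_assoc]
      _ = 0 := by rw [h0, Matrix.mul_zero]
  have := congrArg Matrix.transpose (sub_eq_zero.1 hK)
  rw [Matrix.transpose_mul, h.transpose_left] at this
  exact this.symm

/-- The range of the pseudoinverse lies in that of the symmetric Gram matrix, which `indicatorMatrix
M` fixes. No independence of columns is needed. -/
theorem lse_eq_zero (X : Matrix (Fin n) (Fin p) ℝ) (M : Finset (Fin p)) (y : Fin n → ℝ) :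
    ∀ j, j ∉ M → lse X M y j = 0 := by
  have hs := pinv_spec _ (gram_transpose X M)
  have hDG := hs.mul_eq_of_mul_eq (D := indicatorMatrix M) (gram_transpose X M) (by
    simp only [← Matrix.mul_assoc, indicatorMatrix_mul_self])
  rw [← indicatorMatrix_mulVec_eq_self_iff, lse, Matrix.mulVec_mulVec, ← Matrix.mul_assoc,
    ← Matrix.mul_assoc, hDG]

/-- The normal equations. -/
theorem normal_equations (X : Matrix (Fin n) (Fin p) ℝ) (M : Finset (Fin p)) (y : Fin n → ℝ) :
    (indicatorMatrix M * X.transpose).mulVec (y - X.mulVec (lse X M y)) = 0 := by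
  have hs := pinv_spec _ (gram_transpose X M)
  have hB : (X * indicatorMatrix M).transpose * (X * indicatorMatrix M)
      = indicatorMatrix M * X.transpose * X * indicatorMatrix M := by
    simp [Matrix.transpose_mul, indicatorMatrix_transpose, Matrix.mul_assoc]
  -- The inserted indicator completes the Gram matrix of `X * indicatorMatrix M`, to which `key`
  -- applies.
  have hl : lse X M y = (indicatorMatrix M).mulVec (lse X M y) :=
    ((indicatorMatrix_mulVec_eq_self_iff M _).2 (lse_eq_zero X M y)).symm
  have key := IsMoorePenrose.gram_mul_mul_transpose (B := X * indicatorMatrix M)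
    (G := pinv (indicatorMatrix M * X.transpose * X * indicatorMatrix M)) (by rwa [hB])
  rw [hB, Matrix.transpose_mul, indicatorMatrix_transpose] at key
  rw [Matrix.mulVec_sub, hl, lse, Matrix.mulVec_mulVec, Matrix.mulVec_mulVec,
    Matrix.mulVec_mulVec, sub_eq_zero]
  conv_lhs => rw [← key]
  simp only [Matrix.mul_assoc]

theorem dotProduct_mulVec_residual (X : Matrix (Fin n) (Fin p) ℝ) (M : Finset (Fin p))
    (y : Fin n → ℝ) (b : Fin p → ℝ) (hb : ∀ j, j ∉ M → b j = 0) :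
    (y - X.mulVec (lse X M y)) ⬝ᵥ X.mulVec b = 0 := by
  rw [← (indicatorMatrix_mulVec_eq_self_iff M b).2 hb, Matrix.mulVec_mulVec,
    Matrix.dotProduct_mulVec, ← Matrix.mulVec_transpose, Matrix.transpose_mul,
    indicatorMatrix_transpose, normal_equations, zero_dotProduct]

/-- `X lse` is the best approximation of `y` in the span of the columns of the model. -/
theorem sqNorm_residual_le (X : Matrix (Fin n) (Fin p) ℝ) (M : Finset (Fin p))
    (y : Fin n → ℝ) (b : Fin p → ℝ) (hb : ∀ j, j ∉ M → b j = 0) :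
    sqNorm (y - X.mulVec (lse X M y)) ≤ sqNorm (y - X.mulVec b) := by
  have h : y - X.mulVec b = (y - X.mulVec (lse X M y)) + X.mulVec (lse X M y - b) := by
    rw [Matrix.mulVec_sub]; abel
  rw [h, sqNorm_add, dotProduct_mulVec_residual X M y (lse X M y - b) fun j hj => by
    simp [lse_eq_zero X M y j hj, hb j hj]]
  linarith [sqNorm_nonneg (X.mulVec (lse X M y - b))]

end Projection

/-! ### Exponential moments of Gaussian quadratic forms. -/

section GaussianMoment

/-- The exponential moment of the square of a standard Gaussian variable. -/
theorem lintegral_exp_mul_sq_gaussianReal {s : ℝ} (hs : 2 * s < 1) :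
    ∫⁻ x, ENNReal.ofReal (Real.exp (s * x ^ 2)) ∂(gaussianReal 0 1)
      = ENNReal.ofReal (√(1 - 2 * s))⁻¹ := by
  have h1 : 0 < 1 - 2 * s := by linarith
  -- Tilting the standard normal density by `exp (s x²)` gives a multiple of the centred normal
  -- density of variance `v`; the multiple is the integral.
  set v : NNReal := (1 - 2 * s)⁻¹.toNNReal with hv
  have hvc : (v : ℝ) = (1 - 2 * s)⁻¹ := Real.coe_toNNReal _ (inv_pos.2 h1).le
  have hv0 : v ≠ 0 := (Real.toNNReal_pos.2 (inv_pos.2 h1)).ne'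
  rw [gaussianReal_of_var_ne_zero _ one_ne_zero,
    lintegral_withDensity_eq_lintegral_mul _ (measurable_gaussianPDF 0 1) (by fun_prop)]
  have hpt : ∀ x : ℝ, (gaussianPDF 0 1 * fun x => ENNReal.ofReal (Real.exp (s * x ^ 2))) x
      = ENNReal.ofReal (√(1 - 2 * s))⁻¹ * gaussianPDF 0 v x := by
    intro x
    rw [Pi.mul_apply, gaussianPDF, gaussianPDF, ← ENNReal.ofReal_mul (gaussianPDFReal_nonneg _ _ _),
      ← ENNReal.ofReal_mul (by positivity)]
    congr 1
    rw [gaussianPDFReal, gaussianPDFReal, mul_assoc, ← Real.exp_add, ← mul_assoc, hvc]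
    congr 1
    · rw [Real.sqrt_mul' _ (inv_pos.2 h1).le, Real.sqrt_inv]
      have : √(1 - 2 * s) ≠ 0 := (Real.sqrt_pos.2 h1).ne'
      simp
      field_simp
    · congr 1
      simp
      field_simp
      ring
  simp_rw [hpt]
  rw [lintegral_const_mul _ (measurable_gaussianPDF 0 v), lintegral_gaussianPDF_eq_one _ hv0,
    mul_one]

theorem lintegral_pi_prod {ι : Type*} [Fintype ι] (μ : ι → Measure ℝ)
    [∀ i, IsProbabilityMeasure (μ i)] (f : ι → ℝ → ENNReal) (hf : ∀ i, Measurable (f i)) :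
    ∫⁻ x, ∏ i, f i (x i) ∂(Measure.pi μ) = ∏ i, ∫⁻ t, f i t ∂(μ i) := by
  have h := (iIndepFun_pi (μ := μ) (X := f) (fun i => (hf i).aemeasurable))
  rw [lintegral_prod_eq_prod_lintegral_of_indepFun Finset.univ _ h
    (fun i => (hf i).comp (measurable_pi_apply i))]
  refine Finset.prod_congr rfl fun i _ => ?_
  exact (measurePreserving_eval μ i).lintegral_comp (hf i)

variable {E : Type*} [NormedAddCommGroup E] [InnerProductSpace ℝ E] [FiniteDimensional ℝ E]
  [MeasurableSpace E] [BorelSpace E]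

/-- The exponential moment of the squared norm of the projection of a standard Gaussian vector
to a subspace, a chi-square variable. -/
theorem lintegral_exp_mul_sq_norm_starProjection (V : Submodule ℝ E) {s : ℝ} (hs : 2 * s < 1) :
    ∫⁻ x, ENNReal.ofReal (Real.exp (s * ‖V.starProjection x‖ ^ 2)) ∂(stdGaussian E)
      = ENNReal.ofReal (√(1 - 2 * s))⁻¹ ^ Module.finrank ℝ V := by
  classical
  let w := stdOrthonormalBasis ℝ V
  have hw : Orthonormal ℝ (fun i => (w i : E)) := w.orthonormal.comp_linearIsometry V.subtypeₗᵢ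
  -- In an orthonormal basis of `E` extending one of `V`, the squared norm of the projection is the
  -- sum of the squared coordinates in `t`, and the Gaussian coordinates are independent.
  obtain ⟨u, b, hvu, hb⟩ := hw.toSubtypeRange.exists_orthonormalBasis_extension
  have hwu : ∀ i, (w i : E) ∈ u := fun i => by
    have := hvu (Set.mem_range_self i)
    simpa using this
  let t : Finset u := Finset.univ.image fun i => ⟨(w i : E), hwu i⟩
  have hinj : Function.Injective fun i => (⟨(w i : E), hwu i⟩ : u) := by
    intro i j h
    exact w.toBasis.injective (by
      rw [w.coe_toBasis]; exact Subtype.ext (by simpa using h))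
  have hcard : t.card = Module.finrank ℝ V := by
    rw [Finset.card_image_of_injective _ hinj, Finset.card_univ, Fintype.card_fin]
  have hnorm : ∀ x : u → ℝ, ‖V.starProjection (∑ i, x i • b i)‖ ^ 2 = ∑ i ∈ t, x i ^ 2 := by
    intro x
    rw [Finset.sum_image (fun i _ j _ h => hinj h), V.starProjection_apply, ← Submodule.coe_norm,
      ← w.sum_sq_inner_right]
    refine Finset.sum_congr rfl fun i _ => ?_
    have h := b.orthonormal.inner_right_fintype x ⟨(w i : E), hwu i⟩
    rw [congrFun hb] at h
    rw [Submodule.inner_orthogonalProjectionOnto_eq_of_mem_left, ← h]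
  rw [stdGaussian_eq_map_pi_orthonormalBasis b, lintegral_map (by fun_prop) (by fun_prop)]
  have hpt : ∀ x : u → ℝ, ENNReal.ofReal (Real.exp (s * ‖V.starProjection (∑ i, x i • b i)‖ ^ 2))
      = ∏ i, (if i ∈ t then fun y : ℝ => ENNReal.ofReal (Real.exp (s * y ^ 2))
          else fun _ => 1) (x i) := by
    intro x
    rw [hnorm, Finset.mul_sum, Real.exp_sum, ENNReal.ofReal_prod_of_nonneg (by
      intros; positivity), ← Finset.prod_subset (Finset.subset_univ t)]
    · exact Finset.prod_congr rfl fun i hi => by simp [hi]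
    · intro i _ hi; simp [hi]
  simp_rw [hpt]
  rw [lintegral_pi_prod _ _ (by intro i; split_ifs <;> fun_prop),
    ← Finset.prod_subset (Finset.subset_univ t), ← hcard, ← Finset.prod_const]
  · refine Finset.prod_congr rfl fun i hi => ?_
    simp [hi, lintegral_exp_mul_sq_gaussianReal hs]
  · intro i _ hi; simp [hi]

/-- The noise is `σ` times a standard Gaussian vector. -/
theorem lintegral_noiseLaw (n : ℕ) (σ : ℝ) (f : (Fin n → ℝ) → ENNReal) (hf : Measurable f) :
    ∫⁻ ε, f ε ∂(noiseLaw n σ)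
      = ∫⁻ z, f (σ • (z : Fin n → ℝ)) ∂(stdGaussian (EuclideanSpace ℝ (Fin n))) := by
  have h : noiseLaw n σ = (Measure.pi fun _ : Fin n => gaussianReal 0 1).map fun x => σ • x := by
    rw [noiseLaw]
    have h1 : gaussianReal 0 (σ ^ 2).toNNReal = (gaussianReal 0 1).map (σ * ·) := by
      rw [gaussianReal_map_const_mul]
      congr 1
      · simp
      · ext; simp [sq_nonneg]
    simp_rw [h1]
    rw [← Measure.pi_map_pi (fun _ => by fun_prop)]
    rfl
  rw [h, lintegral_map hf (by fun_prop), ← map_pi_eq_stdGaussian, lintegral_map (by fun_prop)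
    (by fun_prop)]

end GaussianMoment

/-! ### The deterministic oracle inequality. -/

section Oracle

variable {n p r : ℕ} {X : Matrix (Fin n) (Fin p) ℝ} {Ω : Finset (Finset (Fin p))}
  {σ γ c : ℝ} {π : ℕ → ℝ} {Mhat : (Fin n → ℝ) → Finset (Fin p)}

/-- The span of the columns of `X` in the model `M` and of the mean vector `X β`. -/
noncomputable def modelSpace (X : Matrix (Fin n) (Fin p) ℝ) (β : Fin p → ℝ)
    (M : Finset (Fin p)) : Submodule ℝ (EuclideanSpace ℝ (Fin n)) :=
  Submodule.span ℝ (Set.range fun o : Option M =>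
    (WithLp.toLp 2 (o.elim (X.mulVec β) fun j => X.transpose j) : EuclideanSpace ℝ (Fin n)))

theorem finrank_modelSpace_le (X : Matrix (Fin n) (Fin p) ℝ) (β : Fin p → ℝ)
    (M : Finset (Fin p)) : Module.finrank ℝ (modelSpace X β M) ≤ M.card + 1 := by
  refine (finrank_range_le_card _).trans ?_
  simp

theorem mulVec_sub_mem_modelSpace (X : Matrix (Fin n) (Fin p) ℝ) (β b : Fin p → ℝ)
    (M : Finset (Fin p)) (hb : ∀ j, j ∉ M → b j = 0) :
    WithLp.toLp 2 (X.mulVec b - X.mulVec β) ∈ modelSpace X β M := by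
  rw [WithLp.toLp_sub]
  refine Submodule.sub_mem _ ?_ (Submodule.subset_span ⟨none, rfl⟩)
  have h : X.mulVec b = ∑ j ∈ M, b j • X.transpose j := by
    rw [Matrix.mulVec_eq_sum, ← Finset.sum_subset (Finset.subset_univ M)]
    · simp
    · intro j _ hj
      simp [hb j hj]
  rw [h, WithLp.toLp_sum]
  refine Submodule.sum_mem _ fun j hj => ?_
  rw [WithLp.toLp_smul]
  exact Submodule.smul_mem _ _ (Submodule.subset_span ⟨some ⟨j, hj⟩, rfl⟩)

theorem sqNorm_eq_norm_sq (v : Fin n → ℝ) :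
    sqNorm v = ‖(WithLp.toLp 2 v : EuclideanSpace ℝ (Fin n))‖ ^ 2 := by
  rw [EuclideanSpace.real_norm_sq_eq]; rfl

/-- The dot product with a vector of a subspace only sees the projection to this subspace. -/
theorem dotProduct_le_norm_starProjection (V : Submodule ℝ (EuclideanSpace ℝ (Fin n)))
    (ε v : Fin n → ℝ) (hv : WithLp.toLp 2 v ∈ V) :
    ε ⬝ᵥ v ≤ ‖V.starProjection (WithLp.toLp 2 ε)‖ *
      ‖(WithLp.toLp 2 v : EuclideanSpace ℝ (Fin n))‖ := by
  have h1 : ε ⬝ᵥ v = inner ℝ (WithLp.toLp 2 ε : EuclideanSpace ℝ (Fin n)) (WithLp.toLp 2 v) := by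
    simp [EuclideanSpace.inner_eq_star_dotProduct, dotProduct_comm]
  have h2 : inner ℝ (WithLp.toLp 2 ε : EuclideanSpace ℝ (Fin n)) (WithLp.toLp 2 v)
      = inner ℝ (V.starProjection (WithLp.toLp 2 ε)) (WithLp.toLp 2 v) := by
    rw [Submodule.starProjection_apply]
    exact (Submodule.inner_orthogonalProjectionOnto_eq_of_mem_right (⟨_, hv⟩ : V) _).symm
  rw [h1, h2]
  exact real_inner_le_norm _ _

/-- The deterministic inequality behind the oracle bound. -/
theorem sqNorm_selected_sub_le (hM : IsMAPSelector X Ω σ γ π Mhat) {β : Fin p → ℝ}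
    {M : Finset (Fin p)} (hMΩ : M ∈ Ω) (hβ : ∀ j, j ∉ M → β j = 0) (ε : Fin n → ℝ) :
    sqNorm (X.mulVec (lse X (Mhat (X.mulVec β + ε)) (X.mulVec β + ε)) - X.mulVec β)
      ≤ pen Ω σ γ π M.card + 2 * (ε ⬝ᵥ
          (X.mulVec (lse X (Mhat (X.mulVec β + ε)) (X.mulVec β + ε)) - X.mulVec β))
        - pen Ω σ γ π (Mhat (X.mulVec β + ε)).card := by
  set y := X.mulVec β + ε with hy
  have h1 := (hM y).2 M hMΩ
  -- `β` competes in the least squares problem of `M` with residual exactly `ε`, so `‖ε‖²` will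
  -- cancel.
  have h2 := sqNorm_residual_le X M y β hβ
  have h3 : y - X.mulVec β = ε := by simp [hy]
  set v := X.mulVec (lse X (Mhat y) y) - X.mulVec β with hv
  have h4 : ε = (y - X.mulVec (lse X (Mhat y) y)) + v := by rw [hv, hy]; abel
  have h5 : sqNorm (y - X.mulVec (lse X (Mhat y) y)) = sqNorm ε - 2 * (ε ⬝ᵥ v) + sqNorm v := by
    have h6 : y - X.mulVec (lse X (Mhat y) y) = ε - v := by rw [h4]; abel
    rw [h6]
    simp only [sqNorm_eq_dotProduct, sub_dotProduct, dotProduct_sub, dotProduct_comm v ε]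
    ring
  rw [h3] at h2
  unfold criterion at h1
  linarith

/-- Up to the factor `1 - θ = 1 / (4γ + 2)`, the loss exceeds the penalty of a true model by at
most a multiple of a sum of exponentials over the admissible models. -/
theorem sqNorm_selected_sub_le_sum_exp (hγ : 0 < γ) (hσ : 0 < σ)
    (hM : IsMAPSelector X Ω σ γ π Mhat) {β : Fin p → ℝ}
    {M : Finset (Fin p)} (hMΩ : M ∈ Ω) (hβ : ∀ j, j ∉ M → β j = 0)
    (z : EuclideanSpace ℝ (Fin n)) :
    sqNorm (X.mulVec (lse X (Mhat (X.mulVec β + σ • (z : Fin n → ℝ)))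
        (X.mulVec β + σ • (z : Fin n → ℝ))) - X.mulVec β)
      ≤ (4 * γ + 2) * pen Ω σ γ π M.card + (4 * γ + 2) * (8 * (γ + 1) * σ ^ 2) *
        ∑ m ∈ Ω, Real.exp (-((4 * γ + 1) / (8 * (γ + 1)) * pen Ω σ γ π m.card / σ ^ 2)) *
          Real.exp ((2 * γ + 1) / (4 * (γ + 1)) * ‖(modelSpace X β m).starProjection z‖ ^ 2) := by
  have h1 := sqNorm_selected_sub_le hM hMΩ hβ (σ • (z : Fin n → ℝ))
  set y := X.mulVec β + σ • (z : Fin n → ℝ) with hy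
  set m := Mhat y with hm
  set v := X.mulVec (lse X m y) - X.mulVec β with hv
  have hmem : WithLp.toLp 2 v ∈ modelSpace X β m :=
    mulVec_sub_mem_modelSpace X β _ m (lse_eq_zero X m y)
  have h2 := dotProduct_le_norm_starProjection (modelSpace X β m) (z : Fin n → ℝ) v hmem
  rw [sqNorm_eq_norm_sq] at h1 ⊢
  set V := modelSpace X β m
  have hz : (WithLp.toLp 2 (z : Fin n → ℝ) : EuclideanSpace ℝ (Fin n)) = z := rfl
  rw [hz] at h2
  rw [smul_dotProduct, smul_eq_mul] at h1
  set N := ‖(WithLp.toLp 2 v : EuclideanSpace ℝ (Fin n))‖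
  set Q := ‖V.starProjection z‖
  set P := pen Ω σ γ π m.card
  set P₀ := pen Ω σ γ π M.card
  -- This is `σ² Q² / θ - P` times `(4γ + 1) / (8 (γ + 1) σ²)`. With this scaling the coefficient
  -- `s` of `Q²` satisfies `1 - 2s = 1 / (2 (γ + 1))`, so the exponential moment is finite.
  set t := (2 * γ + 1) / (4 * (γ + 1)) * Q ^ 2 - (4 * γ + 1) / (8 * (γ + 1)) * P / σ ^ 2 with ht
  have hexp : t ≤ ∑ m ∈ Ω,
      Real.exp (-((4 * γ + 1) / (8 * (γ + 1)) * pen Ω σ γ π m.card / σ ^ 2)) *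
        Real.exp ((2 * γ + 1) / (4 * (γ + 1)) * ‖(modelSpace X β m).starProjection z‖ ^ 2) := by
    have h3 : t ≤ Real.exp t := by linarith [Real.add_one_le_exp t]
    have h4 : Real.exp t = Real.exp (-((4 * γ + 1) / (8 * (γ + 1)) * P / σ ^ 2)) *
        Real.exp ((2 * γ + 1) / (4 * (γ + 1)) * Q ^ 2) := by
      rw [← Real.exp_add, ht]; congr 1; ring
    rw [h4] at h3
    exact h3.trans (Finset.single_le_sum (f := fun m =>
      Real.exp (-((4 * γ + 1) / (8 * (γ + 1)) * pen Ω σ γ π m.card / σ ^ 2)) *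
        Real.exp ((2 * γ + 1) / (4 * (γ + 1)) * ‖(modelSpace X β m).starProjection z‖ ^ 2))
      (fun _ _ => by positivity) (hM y).1)
  set S := ∑ m ∈ Ω, Real.exp (-((4 * γ + 1) / (8 * (γ + 1)) * pen Ω σ γ π m.card / σ ^ 2)) *
        Real.exp ((2 * γ + 1) / (4 * (γ + 1)) * ‖(modelSpace X β m).starProjection z‖ ^ 2)
  have hS : 0 ≤ S := Finset.sum_nonneg fun _ _ => by positivity
  have h5 : N ^ 2 ≤ P₀ + 2 * (σ * (Q * N)) - P := by
    have := mul_le_mul_of_nonneg_left h2 hσ.le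
    linarith
  -- `2 σ Q N ≤ θ N² + σ² Q² / θ` with `θ = (4γ + 1) / (4γ + 2)`
  have h6 : (4 * γ + 2) * (4 * γ + 1) * (2 * (σ * (Q * N))) ≤
      (4 * γ + 1) ^ 2 * N ^ 2 + (4 * γ + 2) ^ 2 * (σ * Q) ^ 2 := by
    nlinarith [sq_nonneg ((4 * γ + 1) * N - (4 * γ + 2) * (σ * Q))]
  have h7 : (4 * γ + 1) * N ^ 2 ≤ (4 * γ + 1) * (4 * γ + 2) * P₀ +
      ((4 * γ + 2) ^ 2 * (σ * Q) ^ 2 - (4 * γ + 2) * (4 * γ + 1) * P) := by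
    have := mul_le_mul_of_nonneg_left h5 (by positivity : 0 ≤ (4 * γ + 2) * (4 * γ + 1))
    nlinarith
  have h8 : (4 * γ + 2) ^ 2 * (σ * Q) ^ 2 - (4 * γ + 2) * (4 * γ + 1) * P
      = (4 * γ + 2) * (8 * (γ + 1) * σ ^ 2) * t := by
    rw [ht]; field_simp; ring
  -- The factor `4γ + 1 ≥ 1` is given away.
  have h9 : (4 * γ + 2) * (8 * (γ + 1) * σ ^ 2) * t ≤
      (4 * γ + 1) * ((4 * γ + 2) * (8 * (γ + 1) * σ ^ 2) * S) := by
    have h10 : (4 * γ + 2) * (8 * (γ + 1) * σ ^ 2) * t ≤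
        (4 * γ + 2) * (8 * (γ + 1) * σ ^ 2) * S := by gcongr
    have h11 : 0 ≤ (4 * γ + 2) * (8 * (γ + 1) * σ ^ 2) * S := by positivity
    nlinarith
  have h12 : (4 * γ + 1) * N ^ 2 ≤ (4 * γ + 1) * ((4 * γ + 2) * P₀ +
      (4 * γ + 2) * (8 * (γ + 1) * σ ^ 2) * S) := by
    rw [h8] at h7; linarith
  exact le_of_mul_le_mul_left h12 (by positivity)

end Oracle

/-! ### The penalty against the prior. -/

section Penalty

variable {n p r : ℕ} {X : Matrix (Fin n) (Fin p) ℝ} {Ω : Finset (Finset (Fin p))}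
  {σ γ c : ℝ} {π : ℕ → ℝ}

theorem IsSizePrior.pos (hπ : IsSizePrior Ω r π) {k : ℕ} (hk : k ≤ r)
    (hm : 0 < modelCount Ω k) : 0 < π k :=
  (hπ.nonneg k hk).lt_of_ne fun h => hm.ne' ((hπ.eq_zero_iff k hk).1 h.symm)

theorem IsSizePrior.le_one (hπ : IsSizePrior Ω r π) {k : ℕ} (hk : k ≤ r) : π k ≤ 1 := by
  rw [← hπ.sum_eq_one]
  exact Finset.single_le_sum (fun i hi => hπ.nonneg i (Nat.lt_succ_iff.1 (Finset.mem_range.1 hi)))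
    (Finset.mem_range.2 (Nat.lt_succ_of_le hk))

theorem pen_eq (hγ : 0 < γ) {k : ℕ} (hm : 0 < modelCount Ω k) (hπ : 0 < π k) :
    pen Ω σ γ π k = 2 * σ ^ 2 * (1 + 1 / γ) *
      (Real.log (modelCount Ω k) - Real.log (π k) + k / 2 * Real.log (1 + γ)) := by
  have hm' : (0 : ℝ) < modelCount Ω k := by exact_mod_cast hm
  rw [pen, Real.log_mul (by positivity) (by positivity), Real.log_mul (by positivity)
    (by positivity), Real.log_inv, Real.log_rpow (by positivity)]
  ring

/-- Size 0 is outside `PriorBounds`; there `π(0) ≤ 1 ≤ m(0)` suffices. -/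
theorem prior_log_bound (hπ : IsSizePrior Ω r π) (hb : PriorBounds Ω r γ c π) {k : ℕ}
    (hk : k ≤ r) (hm : 0 < modelCount Ω k) :
    Real.log (π k) - Real.log (modelCount Ω k) ≤ -cGamma γ * k := by
  have hm' : (1 : ℝ) ≤ modelCount Ω k := by exact_mod_cast hm
  have hp := hπ.pos hk hm
  rcases Nat.eq_zero_or_pos k with rfl | hk0
  · have := Real.log_nonpos hp.le (hπ.le_one hk)
    have := Real.log_nonneg hm'
    simp; linarith
  · have h := Real.log_le_log hp (hb k hk0 hk hm).2
    rw [Real.log_mul (by positivity) (by positivity), Real.log_exp] at h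
    linarith

/-- The penalty outweighs the exponential moment of the noise in a model. -/
theorem exp_neg_pen_mul_le (hγ : 0 < γ) (hσ : 0 < σ) (hπ : IsSizePrior Ω r π)
    (hb : PriorBounds Ω r γ c π) {k : ℕ} (hk : k ≤ r) (hm : 0 < modelCount Ω k) :
    Real.exp (-((4 * γ + 1) / (8 * (γ + 1)) * pen Ω σ γ π k / σ ^ 2)) *
        √(2 * (1 + γ)) ^ (k + 1) ≤ √(2 * (1 + γ)) * (π k / modelCount Ω k) := by
  have hm' : (0 : ℝ) < modelCount Ω k := by exact_mod_cast hm
  have hp := hπ.pos hk hm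
  have hq := prior_log_bound hπ hb hk hm
  -- The extra dimension, due to the mean vector, only contributes the outer constant.
  rw [pow_succ' √(2 * (1 + γ)) k, mul_left_comm]
  refine mul_le_mul_of_nonneg_left ?_ (Real.sqrt_nonneg _)
  rw [← Real.log_le_log_iff (by positivity) (by positivity), Real.log_mul (by positivity)
    (by positivity), Real.log_exp, Real.log_pow, Real.log_sqrt (by positivity),
    Real.log_mul (by positivity) (by positivity), Real.log_div hp.ne' hm'.ne', pen_eq hγ hm hp]
  have hl2 : Real.log 2 ≤ 1 := by linarith [Real.log_le_sub_one_of_pos (zero_lt_two' ℝ)]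
  have hlg : 0 ≤ Real.log (1 + γ) := Real.log_nonneg (by linarith)
  set a := Real.log (π k)
  set b := Real.log (modelCount Ω k)
  set L := Real.log (1 + γ)
  have hk0 : (0 : ℝ) ≤ k := Nat.cast_nonneg k
  -- The exponent exceeds 1 by `1 / (4γ)`. The power 1 yields `π / m` and cancels `(1 + γ)^(k/2)`;
  -- the surplus must pay for `2^(k/2)`.
  have he : (4 * γ + 1) / (8 * (γ + 1)) * (2 * σ ^ 2 * (1 + 1 / γ) * (b - a + k / 2 * L)) / σ ^ 2
      = (1 + 1 / (4 * γ)) * (b - a + k / 2 * L) := by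
    field_simp; ring
  rw [he]
  -- The arithmetic-geometric mean inequality for `γ` and `3/4`.
  have hc : 24 * γ ≤ cGamma γ := by
    unfold cGamma; nlinarith [sq_nonneg (γ - 3 / 4)]
  have h1 : 24 * γ * k ≤ b - a := by
    have := mul_le_mul_of_nonneg_right hc hk0
    linarith
  have h2 : 6 * (k : ℝ) ≤ 1 / (4 * γ) * (b - a) := by
    have := mul_le_mul_of_nonneg_left h1 (by positivity : 0 ≤ 1 / (4 * γ))
    calc 6 * (k : ℝ) = 1 / (4 * γ) * (24 * γ * k) := by field_simp; ring
      _ ≤ _ := this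
  have h3 : 0 ≤ 1 / (4 * γ) * (k / 2 * L) := by positivity
  nlinarith [mul_le_mul_of_nonneg_left hl2 hk0]

/-- Spreading `π(k)` evenly over the `m(k)` models of size `k` turns the sum into the total mass of
the prior. -/
theorem sum_prior_div_count_le (hΩ : ∀ M ∈ Ω, M.card ≤ r) (hπ : IsSizePrior Ω r π) :
    ∑ M ∈ Ω, π M.card / modelCount Ω M.card ≤ 1 := by
  rw [← hπ.sum_eq_one, ← Finset.sum_fiberwise_of_maps_to (g := Finset.card)
    (t := Finset.range (r + 1)) fun M hM => Finset.mem_range.2 (Nat.lt_succ_of_le (hΩ M hM))]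
  refine Finset.sum_le_sum fun k hk => ?_
  have hk' := hπ.nonneg k (Nat.lt_succ_iff.1 (Finset.mem_range.1 hk))
  rw [Finset.sum_congr rfl (g := fun _ => π k / modelCount Ω k) fun M hM => by
    rw [(Finset.mem_filter.1 hM).2], Finset.sum_const, nsmul_eq_mul]
  change (modelCount Ω k : ℝ) * _ ≤ _
  by_cases h : (modelCount Ω k : ℝ) = 0
  · simpa [h] using hk'
  · rw [mul_div_cancel₀ _ h]

/-- Whichever term attains the minimum in the lower prior bound, `-log π(k)` is at most `c` times
the corresponding entry of the maximum. -/
theorem pen_le (hγ : 0 < γ) (hc : 0 < c) (hπ : IsSizePrior Ω r π)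
    (hb : PriorBounds Ω r γ c π) {k : ℕ} (hk1 : 1 ≤ k) (hk : k ≤ r) (hm : 0 < modelCount Ω k) :
    pen Ω σ γ π k ≤ 2 * (1 + 1 / γ) * (1 + γ) * (1 + c) * σ ^ 2 *
      max (k : ℝ) (Real.log (modelCount Ω k)) := by
  have hm' : (0 : ℝ) < modelCount Ω k := by exact_mod_cast hm
  have hp := hπ.pos hk hm
  rw [pen_eq hγ hm hp]
  set b := Real.log (modelCount Ω k) with hbdef
  have h1 : -Real.log (π k) ≤ c * max (k : ℝ) b := by
    have h := Real.log_le_log (by positivity) (hb k hk1 hk hm).1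
    rcases min_cases ((modelCount Ω k : ℝ) ^ (-c)) (Real.exp (-c * k)) with ⟨h2, _⟩ | ⟨h2, _⟩
    · rw [h2, Real.log_rpow hm'] at h
      nlinarith [le_max_right (k : ℝ) b]
    · rw [h2, Real.log_exp] at h
      nlinarith [le_max_left (k : ℝ) b]
  have h2 : Real.log (1 + γ) ≤ γ := by linarith [Real.log_le_sub_one_of_pos (by linarith : 0 < 1 + γ)]
  have hB := le_max_left (k : ℝ) b
  have hB' := le_max_right (k : ℝ) b
  set B := max (k : ℝ) b
  have hk0 : (0 : ℝ) ≤ k := Nat.cast_nonneg k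
  have h3 : (k : ℝ) / 2 * Real.log (1 + γ) ≤ γ * B := by
    calc (k : ℝ) / 2 * Real.log (1 + γ) ≤ k / 2 * γ := by gcongr
      _ ≤ γ * B := by nlinarith
  have h4 : b - Real.log (π k) + k / 2 * Real.log (1 + γ) ≤ (1 + γ) * (1 + c) * B := by
    have : 0 ≤ γ * c * B := by positivity
    nlinarith
  calc _ ≤ 2 * σ ^ 2 * (1 + 1 / γ) * ((1 + γ) * (1 + c) * B) := by gcongr
    _ = _ := by ring

end Penalty

/-! ### Risk bounds. -/

section Risk

variable {n p r : ℕ} {X : Matrix (Fin n) (Fin p) ℝ} {Ω : Finset (Finset (Fin p))}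
  {σ γ c : ℝ} {π : ℕ → ℝ} {Mhat : (Fin n → ℝ) → Finset (Fin p)}

theorem lintegral_exp_starProjection_modelSpace_le (hγ : 0 < γ) (β : Fin p → ℝ)
    (m : Finset (Fin p)) :
    ∫⁻ z, ENNReal.ofReal (Real.exp ((2 * γ + 1) / (4 * (γ + 1)) *
        ‖(modelSpace X β m).starProjection z‖ ^ 2)) ∂(stdGaussian (EuclideanSpace ℝ (Fin n)))
      ≤ ENNReal.ofReal (√(2 * (1 + γ)) ^ (m.card + 1)) := by
  have h1 : 1 - 2 * ((2 * γ + 1) / (4 * (γ + 1))) = (2 * (1 + γ))⁻¹ := by field_simp; ring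
  have h0 : 0 < (2 * (1 + γ))⁻¹ := by positivity
  rw [lintegral_exp_mul_sq_norm_starProjection _ (by linarith), h1, Real.sqrt_inv, inv_inv,
    ← ENNReal.ofReal_pow (Real.sqrt_nonneg _)]
  exact ENNReal.ofReal_le_ofReal (pow_le_pow_right₀ (Real.one_le_sqrt.2 (by linarith))
    (finrank_modelSpace_le X β m))

/-- The oracle bound on the risk, for a mean vector in the span of an admissible model. -/
theorem risk_le_pen (hγ : 0 < γ) (hσ : 0 < σ) (hΩ : ∀ M ∈ Ω, M.card ≤ r)
    (hπ : IsSizePrior Ω r π) (hb : PriorBounds Ω r γ c π) (hM : IsMAPSelector X Ω σ γ π Mhat)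
    {β : Fin p → ℝ} {M : Finset (Fin p)} (hMΩ : M ∈ Ω) (hβ : ∀ j, j ∉ M → β j = 0) :
    risk X σ Mhat β ≤ ENNReal.ofReal ((4 * γ + 2) * max (pen Ω σ γ π M.card) 0) +
      ENNReal.ofReal ((4 * γ + 2) * (8 * (γ + 1) * σ ^ 2) * √(2 * (1 + γ))) := by
  set P := max (pen Ω σ γ π M.card) 0
  set K := (4 * γ + 2) * (8 * (γ + 1) * σ ^ 2) with hK
  have hK0 : 0 ≤ K := by positivity
  set a : Finset (Fin p) → ℝ := fun m =>
    Real.exp (-((4 * γ + 1) / (8 * (γ + 1)) * pen Ω σ γ π m.card / σ ^ 2))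
  set e : Finset (Fin p) → EuclideanSpace ℝ (Fin n) → ℝ := fun m z =>
    Real.exp ((2 * γ + 1) / (4 * (γ + 1)) * ‖(modelSpace X β m).starProjection z‖ ^ 2)
  have hem : ∀ m, Measurable (e m) := fun m => by fun_prop
  -- A measurable majorant: the selector may be non-measurable, but monotonicity of the lower
  -- integral does not need measurability of the loss.
  let f : (Fin n → ℝ) → ENNReal := fun ε => ENNReal.ofReal ((4 * γ + 2) * P) +
    ENNReal.ofReal K * ∑ m ∈ Ω, ENNReal.ofReal (a m) *
      ENNReal.ofReal (e m (WithLp.toLp 2 (σ⁻¹ • ε)))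
  have hf : Measurable f := by fun_prop
  have hle : ∀ ε, ENNReal.ofReal (sqNorm (X.mulVec (lse X (Mhat (X.mulVec β + ε))
      (X.mulVec β + ε)) - X.mulVec β)) ≤ f ε := by
    intro ε
    have h := sqNorm_selected_sub_le_sum_exp hγ hσ hM hMΩ hβ (WithLp.toLp 2 (σ⁻¹ • ε))
    have hε : σ • ((WithLp.toLp 2 (σ⁻¹ • ε) : EuclideanSpace ℝ (Fin n)) : Fin n → ℝ) = ε := by
      simp [smul_smul, hσ.ne']
    rw [hε] at h
    have hsum : 0 ≤ ∑ m ∈ Ω, a m * e m (WithLp.toLp 2 (σ⁻¹ • ε)) :=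
      Finset.sum_nonneg fun _ _ => by positivity
    have hS : f ε = ENNReal.ofReal ((4 * γ + 2) * P + K * ∑ m ∈ Ω, a m *
        e m (WithLp.toLp 2 (σ⁻¹ • ε))) := by
      rw [ENNReal.ofReal_add (by positivity) (mul_nonneg hK0 hsum),
        ENNReal.ofReal_mul hK0, ENNReal.ofReal_sum_of_nonneg fun _ _ => by positivity]
      simp only [f, ENNReal.ofReal_mul (Real.exp_nonneg _), a]
    rw [hS]
    refine ENNReal.ofReal_le_ofReal (h.trans ?_)
    gcongr
    exact le_max_left _ _
  refine (lintegral_mono hle).trans ?_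
  rw [lintegral_noiseLaw n σ f hf]
  have hfz : ∀ z : EuclideanSpace ℝ (Fin n), f (σ • (z : Fin n → ℝ)) =
      ENNReal.ofReal ((4 * γ + 2) * P) +
        ENNReal.ofReal K * ∑ m ∈ Ω, ENNReal.ofReal (a m) * ENNReal.ofReal (e m z) := by
    intro z
    simp only [f, smul_smul, inv_mul_cancel₀ hσ.ne', one_smul]
  simp_rw [hfz]
  rw [lintegral_add_left measurable_const, lintegral_const, measure_univ, mul_one,
    lintegral_const_mul _ (by fun_prop), lintegral_finsetSum _ (fun m _ => by fun_prop),
    ENNReal.ofReal_mul hK0]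
  gcongr
  calc ∑ m ∈ Ω, ∫⁻ z, ENNReal.ofReal (a m) * ENNReal.ofReal (e m z) ∂(stdGaussian _)
      ≤ ∑ m ∈ Ω, ENNReal.ofReal (√(2 * (1 + γ)) * (π m.card / modelCount Ω m.card)) := by
        refine Finset.sum_le_sum fun m hm => ?_
        rw [lintegral_const_mul _ (by fun_prop)]
        refine (mul_le_mul_right
          (lintegral_exp_starProjection_modelSpace_le hγ β m) _).trans ?_
        rw [← ENNReal.ofReal_mul (by positivity)]
        exact ENNReal.ofReal_le_ofReal (exp_neg_pen_mul_le hγ hσ hπ hb (hΩ m hm)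
          (Finset.card_pos.2 ⟨m, Finset.mem_filter.2 ⟨hm, rfl⟩⟩))
    _ = ENNReal.ofReal (√(2 * (1 + γ)) * ∑ m ∈ Ω, π m.card / modelCount Ω m.card) := by
        rw [Finset.mul_sum, ENNReal.ofReal_sum_of_nonneg]
        intro m hm
        have := hπ.nonneg _ (hΩ m hm)
        positivity
    _ ≤ ENNReal.ofReal √(2 * (1 + γ)) := by
        refine ENNReal.ofReal_le_ofReal (mul_le_of_le_one_right (Real.sqrt_nonneg _) ?_)
        exact sum_prior_div_count_le hΩ hπ

/-- The constant of the risk bounds. -/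
noncomputable def riskConst (γ : ℝ) : ℝ :=
  (4 * γ + 2) * (2 * (1 + 1 / γ) * (1 + γ)) + (4 * γ + 2) * (8 * (γ + 1)) * √(2 * (1 + γ))

theorem riskConst_pos (hγ : 0 < γ) : 0 < riskConst γ := by
  unfold riskConst; positivity

/-- The additive term of order `σ²` in `risk_le_pen` is absorbed thanks to `T ≥ 1`. -/
theorem risk_le_of_pen_le (hγ : 0 < γ) (hσ : 0 < σ) (hc : 0 < c) (hΩ : ∀ M ∈ Ω, M.card ≤ r)
    (hπ : IsSizePrior Ω r π) (hb : PriorBounds Ω r γ c π) (hM : IsMAPSelector X Ω σ γ π Mhat)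
    {β : Fin p → ℝ} {M : Finset (Fin p)} (hMΩ : M ∈ Ω) (hβ : ∀ j, j ∉ M → β j = 0) {T : ℝ}
    (hT : 1 ≤ T)
    (hpen : pen Ω σ γ π M.card ≤ 2 * (1 + 1 / γ) * (1 + γ) * (1 + c) * σ ^ 2 * T) :
    risk X σ Mhat β ≤ ENNReal.ofReal (riskConst γ * (1 + c) * σ ^ 2 * T) := by
  refine (risk_le_pen hγ hσ hΩ hπ hb hM hMΩ hβ).trans ?_
  rw [← ENNReal.ofReal_add (by positivity) (by positivity)]
  refine ENNReal.ofReal_le_ofReal ?_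
  have h1 : max (pen Ω σ γ π M.card) 0 ≤ 2 * (1 + 1 / γ) * (1 + γ) * (1 + c) * σ ^ 2 * T :=
    max_le hpen (by positivity)
  have h2 : 1 ≤ (1 + c) * T := by nlinarith
  have h3 : (4 * γ + 2) * (8 * (γ + 1) * σ ^ 2) * √(2 * (1 + γ)) * 1 ≤
      (4 * γ + 2) * (8 * (γ + 1) * σ ^ 2) * √(2 * (1 + γ)) * ((1 + c) * T) := by gcongr
  have h4 := mul_le_mul_of_nonneg_left h1 (by positivity : 0 ≤ 4 * γ + 2)
  unfold riskConst
  linarith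

/-- A model of `rank X` predictors fits every mean vector. -/
theorem IsSetting.exists_mulVec_eq (h : IsSetting X Ω r) {S : Finset (Fin p)} (hS : S.card = r)
    (β : Fin p → ℝ) : ∃ β' : Fin p → ℝ, (∀ j, j ∉ S → β' j = 0) ∧ X.mulVec β' = X.mulVec β := by
  classical
  have hle : Submodule.span ℝ (Set.range fun j : S => X.transpose j) ≤
      LinearMap.range X.mulVecLin := by
    rw [Submodule.span_le]
    rintro _ ⟨j, rfl⟩
    exact ⟨Pi.single (j : Fin p) 1, by simp; rfl⟩
  have heq := Submodule.eq_of_le_of_finrank_eq hle (by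
    rw [finrank_span_eq_card (h.linearIndependent S hS), Fintype.card_coe, hS, ← h.rank_eq]
    rfl)
  have hmem : X.mulVec β ∈ Submodule.span ℝ (Set.range fun j : S => X.transpose j) := by
    rw [heq]; exact ⟨β, rfl⟩
  obtain ⟨w, hw⟩ := (Submodule.mem_span_range_iff_exists_fun ℝ).1 hmem
  refine ⟨fun j => if hj : j ∈ S then w ⟨j, hj⟩ else 0, fun j hj => by simp [hj], ?_⟩
  rw [← hw, Matrix.mulVec_eq_sum, ← Finset.sum_subset (Finset.subset_univ S), ← Finset.sum_coe_sort]
  · refine Finset.sum_congr rfl fun j _ => ?_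
    simp
  · intro j _ hj
    simp [hj]

theorem risk_congr {β β' : Fin p → ℝ} (h : X.mulVec β' = X.mulVec β) :
    risk X σ Mhat β' = risk X σ Mhat β := by
  unfold risk; rw [h]

/-- The bound of the risk by the rank of the design. -/
theorem risk_le_rank (hγ : 0 < γ) (hσ : 0 < σ) (hc : 0 < c) (hS : IsSetting X Ω r)
    (hπ : IsSizePrior Ω r π) (hb : PriorBounds Ω r γ c π) (hM : IsMAPSelector X Ω σ γ π Mhat)
    (hr : 1 ≤ r) (β : Fin p → ℝ) :
    risk X σ Mhat β ≤ ENNReal.ofReal (riskConst γ * (1 + c) * σ ^ 2 * r) := by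
  have hm : 0 < modelCount Ω r := by rw [hS.count_rank]; exact one_pos
  obtain ⟨S, hSmem⟩ := Finset.card_pos.1 hm
  obtain ⟨hSΩ, hScard⟩ := Finset.mem_filter.1 hSmem
  obtain ⟨β', hβ', hX⟩ := hS.exists_mulVec_eq hScard β
  -- The risk depends on `β` only through `X β`, so `β` may be moved into the saturated model.
  rw [← risk_congr hX]
  refine risk_le_of_pen_le hγ hσ hc hS.card_le hπ hb hM hSΩ hβ' (by exact_mod_cast hr) ?_
  have := pen_le (σ := σ) hγ hc hπ hb hr le_rfl hm
  rw [hScard]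
  simpa [hS.count_rank] using this

theorem risk_le_min (hγ : 0 < γ) (hσ : 0 < σ) (hc : 0 < c) (hS : IsSetting X Ω r)
    (hπ : IsSizePrior Ω r π) (hb : PriorBounds Ω r γ c π) (hM : IsMAPSelector X Ω σ γ π Mhat)
    (hr : 1 ≤ r) {β : Fin p → ℝ} {M : Finset (Fin p)} (hMΩ : M ∈ Ω)
    (hβ : ∀ j, j ∉ M → β j = 0) {T : ℝ} (hT : 1 ≤ T)
    (hpen : pen Ω σ γ π M.card ≤ 2 * (1 + 1 / γ) * (1 + γ) * (1 + c) * σ ^ 2 * T) :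
    risk X σ Mhat β ≤ ENNReal.ofReal (riskConst γ * (1 + c) * σ ^ 2 * min T r) := by
  rcases min_cases T (r : ℝ) with ⟨h, _⟩ | ⟨h, _⟩
  · rw [h]; exact risk_le_of_pen_le hγ hσ hc hS.card_le hπ hb hM hMΩ hβ hT hpen
  · rw [h]; exact risk_le_rank hγ hσ hc hS hπ hb hM hr β

theorem worstRisk_le {S : Finset (Finset (Fin p))} {B : ENNReal}
    (h : ∀ M ∈ S, ∀ β : Fin p → ℝ, (∀ j, j ∉ M → β j = 0) → risk X σ Mhat β ≤ B) :
    worstRisk X σ Mhat S ≤ B :=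
  iSup₂_le fun M hM => iSup₂_le fun β hβ => h M hM β hβ

/-- The worst risk over the models of size at most `q`, when a nonnull one exists and their
penalties are controlled: the null model lies inside any other one. -/
theorem worstRisk_modelsUpTo_le (hγ : 0 < γ) (hσ : 0 < σ) (hc : 0 < c) (hS : IsSetting X Ω r)
    (hπ : IsSizePrior Ω r π) (hb : PriorBounds Ω r γ c π) (hM : IsMAPSelector X Ω σ γ π Mhat)
    (hr : 1 ≤ r) {q : ℕ} (hq : ∃ k : ℕ, 1 ≤ k ∧ k ≤ q ∧ 0 < modelCount Ω k) {T : ℝ} (hT : 1 ≤ T)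
    (hpen : ∀ k : ℕ, 1 ≤ k → k ≤ q → 0 < modelCount Ω k →
      pen Ω σ γ π k ≤ 2 * (1 + 1 / γ) * (1 + γ) * (1 + c) * σ ^ 2 * T) :
    worstRisk X σ Mhat (modelsUpTo Ω q) ≤
      ENNReal.ofReal (riskConst γ * (1 + c) * σ ^ 2 * min T r) := by
  refine worstRisk_le fun M hMq β hβ => ?_
  obtain ⟨hMΩ, hMcard⟩ := Finset.mem_filter.1 hMq
  rcases Finset.eq_empty_or_nonempty M with rfl | hne
  -- `π(0)` has no lower bound, so the null model's own penalty may be huge; the zero vector is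
  -- treated as supported in a nonnull model.
  · obtain ⟨k, hk1, hkq, hk⟩ := hq
    obtain ⟨M', hM'⟩ := Finset.card_pos.1 hk
    obtain ⟨hM'Ω, hM'card⟩ := Finset.mem_filter.1 hM'
    refine risk_le_min hγ hσ hc hS hπ hb hM hr hM'Ω (fun j _ => hβ j (by simp)) hT ?_
    rw [hM'card]
    exact hpen k hk1 hkq hk
  · exact risk_le_min hγ hσ hc hS hπ hb hM hr hMΩ hβ hT
      (hpen _ hne.card_pos hMcard (Finset.card_pos.2 ⟨M, Finset.mem_filter.2 ⟨hMΩ, rfl⟩⟩))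

end Risk

end MAPSelection

/-! ### The three bounds. -/

open MAPSelection in
theorem theorem1 (γ : ℝ) (hγ : 0 < γ) :
    ∃ C : ℝ, 0 < C ∧
      ∀ (n p r : ℕ) (X : Matrix (Fin n) (Fin p) ℝ) (Ω : Finset (Finset (Fin p)))
        (σ c : ℝ) (π : ℕ → ℝ) (Mhat : (Fin n → ℝ) → Finset (Fin p)),
        IsSetting X Ω r → 0 < σ → 0 < c → IsSizePrior Ω r π → PriorBounds Ω r γ c π →
        IsMAPSelector X Ω σ γ π Mhat →
        ∀ p₀ : ℕ, 1 ≤ p₀ → p₀ ≤ r →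
          -- models of size at most `p₀`, when no smaller model has a larger penalty
          (0 < modelCount Ω p₀ →
            (p₀ = r ∨ ∀ k : ℕ, 1 ≤ k → k < p₀ → 0 < modelCount Ω k →
              pen Ω σ γ π k ≤ pen Ω σ γ π p₀) →
            worstRisk X σ Mhat (modelsUpTo Ω p₀) ≤
              ENNReal.ofReal (C * (1 + c) * σ ^ 2 *
                min (max (p₀ : ℝ) (Real.log (modelCount Ω p₀))) (r : ℝ))) ∧
          -- models of size exactly `p₀`
          worstRisk X σ Mhat (modelsOfSize Ω p₀) ≤
              ENNReal.ofReal (C * (1 + c) * σ ^ 2 *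
                min (max (p₀ : ℝ) (Real.log (modelCount Ω p₀))) (r : ℝ)) ∧
          -- models of size at most `p₀`, without a condition on the penalty
          ((∃ k : ℕ, 1 ≤ k ∧ k ≤ p₀ ∧ 0 < modelCount Ω k) →
            worstRisk X σ Mhat (modelsUpTo Ω p₀) ≤
              ENNReal.ofReal (C * (1 + c) * σ ^ 2 *
                min (max (p₀ : ℝ)
                  (Real.log ((Finset.Icc 1 p₀).sup (modelCount Ω) : ℕ))) (r : ℝ))) := by
  refine ⟨riskConst γ, riskConst_pos hγ, ?_⟩
  intro n p r X Ω σ c π Mhat hS hσ hc hπ hb hM p₀ hp1 hpr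
  have hr : 1 ≤ r := hp1.trans hpr
  have hp1' : (1 : ℝ) ≤ p₀ := by exact_mod_cast hp1
  have hA : 0 ≤ 2 * (1 + 1 / γ) * (1 + γ) * (1 + c) * σ ^ 2 := by positivity
  refine ⟨fun hm hor => ?_, ?_, fun hex => ?_⟩
  · rcases hor with rfl | hmono
    -- For `p₀ = r` the minimum equals `r`, so the rank bound applies whatever the penalties.
    · refine worstRisk_le fun M _ β _ => ?_
      have h := risk_le_rank hγ hσ hc hS hπ hb hM hr β
      rwa [min_eq_right (le_max_left _ _)]
    · refine worstRisk_modelsUpTo_le hγ hσ hc hS hπ hb hM hr ⟨p₀, hp1, le_rfl, hm⟩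
        (hp1'.trans (le_max_left _ _)) fun k hk1 hk hkm => ?_
      have h0 := pen_le (σ := σ) hγ hc hπ hb hp1 hpr hm
      rcases hk.lt_or_eq with hlt | rfl
      · exact (hmono k hk1 hlt hkm).trans h0
      · exact h0
  · refine worstRisk_le fun M hMq β hβ => ?_
    obtain ⟨hMΩ, hMcard⟩ := Finset.mem_filter.1 hMq
    refine risk_le_min hγ hσ hc hS hπ hb hM hr hMΩ hβ (hp1'.trans (le_max_left _ _)) ?_
    rw [hMcard]
    exact pen_le hγ hc hπ hb hp1 hpr (Finset.card_pos.2 ⟨M, hMq⟩)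
  · refine worstRisk_modelsUpTo_le hγ hσ hc hS hπ hb hM hr hex
      (hp1'.trans (le_max_left _ _)) fun k hk1 hk hkm => ?_
    refine (pen_le hγ hc hπ hb hk1 (hk.trans hpr) hkm).trans (mul_le_mul_of_nonneg_left ?_ hA)
    -- The logarithm of the largest count dominates that of each nonempty size; empty sizes add only
    -- 0 to the supremum.
    have hle : modelCount Ω k ≤ (Finset.Icc 1 p₀).sup (modelCount Ω) :=
      Finset.le_sup (f := modelCount Ω) (Finset.mem_Icc.2 ⟨hk1, hk⟩)
    have hkm' : (0 : ℝ) < modelCount Ω k := by exact_mod_cast hkm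
    exact max_le_max (by exact_mod_cast hk) (Real.log_le_log hkm' (by exact_mod_cast hle))
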